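/- Let $l\in\mathbb N$, $\alpha_1,\dots,\alpha_l\in\mathbb R$, $b_1,\dots,b_l\in\mathbb C$, and let $\varphi(z)=\sum_{j=1}^{l} b_j e^{2\pi i\alpha_j z}$, $z\in\mathbb C$, be an exponential polynomial with zero set $\Lambda_\varphi=\{z\in\mathbb C:\varphi(z)=0\}$. Assume that all zeros of $\varphi$ are simple, that $\Lambda_\varphi$ is uniformly discrete, i.e. $\inf_{\lambda,\lambda'\in\Lambda_\varphi,\ \lambda\neq\lambda'}|\lambda-\lambda'|>0$ (with $\inf\emptyset=+\infty$), and that $\Lambda_\varphi\subset\mathbb R$. Then $$\mu:=\sum_{\lambda\in\Lambda_\varphi}\delta_\lambda$$ is a crystalline measure on $\mathbb R$: $\mu$ is a purely atomic measure supported by a locally finite set, it is a tempered distribution, and its distributional Fourier transform $\hat\mu$ is also a purely atomic (complex) measure supported by a locally finite set. (If $\Lambda_\varphi=\emptyset$, then $\mu=0$, which counts as crystalline.) -/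

import Mathlib

open scoped SchwartzMap FourierTransform

noncomputable section

/-- The class `Exp`: exponential polynomials `ψ(z) = ∑_j b_j e^{2πi α_j z}` with real `α_j` and
complex `b_j`. -/
def IsExpPoly (ψ : ℂ → ℂ) : Prop :=
  ∃ (l : ℕ) (α : Fin l → ℝ) (b : Fin l → ℂ),
    ∀ z : ℂ, ψ z = ∑ j, b j * Complex.exp (2 * Real.pi * Complex.I * α j * z)

/-- The zero set of `ψ` in the complex plane. -/
def zeroSet (ψ : ℂ → ℂ) : Set ℂ := {z | ψ z = 0}

/-- A set `Λ` is uniformly discrete if `inf_{λ ≠ λ'} |λ - λ'| > 0`, the infimum running over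
pairs of distinct points of `Λ` (it is `∞` if there are none). -/
def IsUniformlyDiscrete (Λ : Set ℂ) : Prop := 0 < Λ.einfsep

/-- The class `Exp_s`: exponential polynomials all of whose zeros are simple and whose zero set is
uniformly discrete. -/
structure IsExpPolyS (φ : ℂ → ℂ) : Prop where
  isExpPoly : IsExpPoly φ
  simple : ∀ z ∈ zeroSet φ, deriv φ z ≠ 0
  uniformlyDiscrete : IsUniformlyDiscrete (zeroSet φ)

/-- The class `Exp_r`: members of `Exp_s` with only real zeros. -/
structure IsExpPolyR (φ : ℂ → ℂ) : Prop extends IsExpPolyS φ where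
  real : ∀ z ∈ zeroSet φ, z.im = 0

/-- The tempered distribution `T` on the line is the purely atomic (complex, locally finite)
measure `∑_x c(x) δ_x` with locally finite support: the set `{x | c x ≠ 0}` is locally finite, and
`T` agrees with this measure on all smooth compactly supported test functions `f`. The sum below
has only finitely many nonzero terms. -/
structure IsAtomicMeasure (T : 𝓢'(ℝ, ℂ)) (c : ℝ → ℂ) : Prop where
  locallyFinite : LocallyFiniteSupport c
  apply_eq : ∀ f : 𝓢(ℝ, ℂ), HasCompactSupport f → T f = ∑ᶠ x : ℝ, c x * f x

/-- The measure `∑_x c(x) δ_x` is a crystalline measure: it is purely atomic with locally finite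
support, it is a tempered distribution `T`, and the distributional Fourier transform of `T` is a
purely atomic measure `∑_s a(s) δ_s` with locally finite support. -/
def IsCrystallineMeasure (c : ℝ → ℂ) : Prop :=
  ∃ T : 𝓢'(ℝ, ℂ), IsAtomicMeasure T c ∧ ∃ a : ℝ → ℂ, IsAtomicMeasure (𝓕 T) a

/-- The masses of `∑_{x ∈ Λ} δ_x`: a unit mass at every point of `Λ`. -/
def unitMasses (Λ : Set ℝ) : ℝ → ℂ := Λ.indicator 1

end

/-! Let μ be the counting measure of the zeros. Its Fourier transform pairs with a compactly
supported smooth g as the sum of ĝ(λ) over the zeros λ, and ĝ extends to the entire function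
`laplace g`, which decays quadratically on horizontal strips (`exists_norm_laplace_le`). As the
zeros are real and simple, φ'/φ has residue 1 at each of them. The residue theorem on long
rectangles (`rectIntegral_mul_logDeriv`) therefore turns 2πi times this sum into the integral of ĝ
φ'/φ along a low horizontal line minus that along a high one. The vertical sides vanish in the limit
because |φ| has a uniform lower bound on suitable segments (`exists_uniform_vertical`): horizontal
integer translations only rotate the coefficients, which stay in a compact torus.

On a high line the lowest frequency dominates: φ'/φ = v/(1 - u), where u has only positive
frequencies, bounded away from 0, and is small. Expanding the geometric series gives exponentials
e^{2πiγz} with locally finite frequencies, and Fourier inversion replaces each of them by g(γ)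
(`integral_laplace_mul_quot`). The reflection z ↦ -z handles the low line. The difference of the two
resulting atomic measures, divided by 2πi, is the Fourier transform of μ. Uniform discreteness
serves to make μ tempered (`SeparatedSet.hasTemperateGrowth`). -/

/-! ### Contour integrals over rectangles symmetric about the real axis -/

namespace RectContour

open Complex MeasureTheory Set

/-- The integral of `f` over the boundary of `[a, b] × [-h, h]`, anticlockwise. -/
noncomputable def rectIntegral (f : ℂ → ℂ) (a b h : ℝ) : ℂ :=
  (∫ x : ℝ in a..b, f (x + ((-h : ℝ) : ℂ) * I)) - (∫ x : ℝ in a..b, f (x + (h : ℂ) * I)) +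
    I * (∫ y : ℝ in (-h)..h, f (b + y * I)) - I * ∫ y : ℝ in (-h)..h, f (a + y * I)

/-- The boundary of the rectangle `[a, b] × [-h, h]`. -/
def rectBoundary (a b h : ℝ) : Set ℂ :=
  {z | z.re ∈ Icc a b ∧ z.im ∈ Icc (-h) h ∧ (z.re = a ∨ z.re = b ∨ z.im = h ∨ z.im = -h)}

variable {a b h : ℝ} {f g : ℂ → ℂ}

lemma bottom_mem (hh : 0 < h) {x : ℝ} (hx : x ∈ Icc a b) :
    (x : ℂ) + ((-h : ℝ) : ℂ) * I ∈ rectBoundary a b h := by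
  refine ⟨by simpa using hx, ?_, ?_⟩ <;> simp; linarith

lemma top_mem (hh : 0 < h) {x : ℝ} (hx : x ∈ Icc a b) :
    (x : ℂ) + (h : ℂ) * I ∈ rectBoundary a b h := by
  refine ⟨by simpa using hx, ?_, ?_⟩ <;> simp; linarith

lemma right_mem (hab : a < b) {y : ℝ} (hy : y ∈ Icc (-h) h) :
    (b : ℂ) + (y : ℂ) * I ∈ rectBoundary a b h := by
  refine ⟨by simpa using hab.le, by simpa using hy, ?_⟩ ; simp

lemma left_mem (hab : a < b) {y : ℝ} (hy : y ∈ Icc (-h) h) :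
    (a : ℂ) + (y : ℂ) * I ∈ rectBoundary a b h := by
  refine ⟨by simpa using hab.le, by simpa using hy, ?_⟩ ; simp

lemma rectIntegral_congr (hab : a < b) (hh : 0 < h) (hfg : EqOn f g (rectBoundary a b h)) :
    rectIntegral f a b h = rectIntegral g a b h := by
  have hh' : -h ≤ h := by linarith
  unfold rectIntegral
  congr 1
  · congr 1
    · congr 1 <;> apply intervalIntegral.integral_congr <;> intro x hx <;>
        rw [uIcc_of_le hab.le] at hx
      · exact hfg (bottom_mem hh hx)
      · exact hfg (top_mem hh hx)
    · congr 1; apply intervalIntegral.integral_congr; intro x hx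
      rw [uIcc_of_le hh'] at hx; exact hfg (right_mem hab hx)
  · congr 1; apply intervalIntegral.integral_congr; intro x hx
    rw [uIcc_of_le hh'] at hx; exact hfg (left_mem hab hx)

lemma rectIntegral_add (hab : a < b) (hh : 0 < h) (hf : ContinuousOn f (rectBoundary a b h))
    (hg : ContinuousOn g (rectBoundary a b h)) :
    rectIntegral (fun z => f z + g z) a b h = rectIntegral f a b h + rectIntegral g a b h := by
  have hh' : -h ≤ h := by linarith
  have hor : ∀ F : ℂ → ℂ, ContinuousOn F (rectBoundary a b h) → ∀ t : ℝ,
      (∀ x ∈ Icc a b, (x : ℂ) + (t : ℂ) * I ∈ rectBoundary a b h) →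
      IntervalIntegrable (fun x : ℝ => F (x + (t : ℂ) * I)) volume a b := by
    intro F hF t ht
    apply ContinuousOn.intervalIntegrable
    rw [uIcc_of_le hab.le]
    exact hF.comp (by fun_prop) ht
  have ver : ∀ F : ℂ → ℂ, ContinuousOn F (rectBoundary a b h) → ∀ t : ℝ,
      (∀ y ∈ Icc (-h) h, (t : ℂ) + (y : ℂ) * I ∈ rectBoundary a b h) →
      IntervalIntegrable (fun y : ℝ => F (t + (y : ℂ) * I)) volume (-h) h := by
    intro F hF t ht
    apply ContinuousOn.intervalIntegrable
    rw [uIcc_of_le hh']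
    exact hF.comp (by fun_prop) ht
  unfold rectIntegral
  rw [intervalIntegral.integral_add (hor f hf _ fun x => bottom_mem hh)
      (hor g hg _ fun x => bottom_mem hh),
    intervalIntegral.integral_add (hor f hf _ fun x => top_mem hh) (hor g hg _ fun x => top_mem hh),
    intervalIntegral.integral_add (ver f hf _ fun x => right_mem hab)
      (ver g hg _ fun x => right_mem hab),
    intervalIntegral.integral_add (ver f hf _ fun x => left_mem hab)
      (ver g hg _ fun x => left_mem hab)]
  ring

lemma rectIntegral_const_mul (c : ℂ) :
    rectIntegral (fun z => c * f z) a b h = c * rectIntegral f a b h := by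
  unfold rectIntegral
  simp only [intervalIntegral.integral_const_mul]
  ring

lemma rectIntegral_eq_zero (hab : a < b) (hh : 0 < h)
    (hf : DifferentiableOn ℂ f (Icc a b ×ℂ Icc (-h) h)) : rectIntegral f a b h = 0 := by
  have := integral_boundary_rect_eq_zero_of_differentiableOn f (a + ((-h : ℝ) : ℂ) * I) (b + h * I)
    (by simpa [uIcc_of_le hab.le, uIcc_of_le (show -h ≤ h by linarith)] using hf)
  simpa [rectIntegral] using this

lemma integral_div_eq_log_sub_log {w c : ℂ} {s t : ℝ}
    (hw : ∀ y ∈ uIcc s t, w + c * (y : ℂ) ∈ slitPlane) :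
    ∫ y : ℝ in s..t, c / (w + c * y) = log (w + c * t) - log (w + c * s) := by
  have key : ∀ y ∈ uIcc s t,
      HasDerivAt (fun y : ℝ => log (w + c * y)) (c / (w + c * y)) y := by
    intro y hy
    have h1 : HasDerivAt (fun y : ℝ => w + c * (y : ℂ)) c y := by
      simpa using ((hasDerivAt_id y).ofReal_comp.const_mul c).const_add w
    exact h1.clog_real (hw y hy)
  rw [intervalIntegral.integral_eq_sub_of_hasDerivAt key]
  apply ContinuousOn.intervalIntegrable
  apply ContinuousOn.div (by fun_prop) (by fun_prop)
  exact fun y hy => slitPlane_ne_zero (hw y hy)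

lemma log_neg_I_mul_of_re_pos {z : ℂ} (hr : 0 < z.re) :
    log (-I * z) = log z - I * (Real.pi / 2) := by
  have h1 := abs_lt.1 (abs_arg_lt_pi_div_two_iff.2 (Or.inl hr))
  have hpi := Real.pi_pos
  have h0 : z ≠ 0 := by rintro rfl; simp at hr
  rw [(log_mul_eq_add_log_iff (by simp) h0).2 (by rw [arg_neg_I]; constructor <;> linarith),
    log_neg_I]
  ring

lemma log_I_mul_of_re_pos {z : ℂ} (hr : 0 < z.re) :
    log (I * z) = log z + I * (Real.pi / 2) := by
  have h1 := abs_lt.1 (abs_arg_lt_pi_div_two_iff.2 (Or.inl hr))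
  have hpi := Real.pi_pos
  have h0 : z ≠ 0 := by rintro rfl; simp at hr
  rw [(log_mul_eq_add_log_iff (by simp) h0).2 (by rw [arg_I]; constructor <;> linarith),
    log_I]
  ring

/-- Multiplication by ±1 or ±i moves each edge into the right half-plane, where the principal
logarithm is an antiderivative. The logarithms at the corners cancel; the quarter turns ±iπ/2 add up
to 2πi. -/
lemma rectIntegral_inv_sub {l : ℝ} (hh : 0 < h) (ha : a < l) (hb : l < b) :
    rectIntegral (fun z => 1 / (z - l)) a b h = 2 * Real.pi * I := by
  have e1 : ∫ x : ℝ in a..b, 1 / ((x : ℂ) + ((-h : ℝ) : ℂ) * I - l) =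
      log (I * ((b - l : ℝ) - h * I)) - log (-I * ((l - a : ℝ) + h * I)) := by
    have := integral_div_eq_log_sub_log (w := h - I * l) (c := I) (s := a) (t := b)
      (fun y _ => Or.inl (by simpa using hh))
    convert this using 2
    · ext x
      rw [show (h : ℂ) - I * l + I * x = I * ((x : ℂ) + ((-h : ℝ) : ℂ) * I - l) by
        push_cast; linear_combination (h : ℂ) * I_sq, ← div_div, div_self I_ne_zero]
    · congr 1; push_cast; linear_combination (h : ℂ) * I_sq * (-1)
    · congr 1; push_cast; linear_combination (-h : ℂ) * I_sq
  have e2 : ∫ x : ℝ in a..b, 1 / ((x : ℂ) + (h : ℂ) * I - l) =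
      log (-I * ((b - l : ℝ) + h * I)) - log (I * ((l - a : ℝ) - h * I)) := by
    have := integral_div_eq_log_sub_log (w := h + I * l) (c := -I) (s := a) (t := b)
      (fun y _ => Or.inl (by simpa using hh))
    convert this using 2
    · ext x
      rw [show (h : ℂ) + I * l + -I * x = -I * ((x : ℂ) + (h : ℂ) * I - l) by
        linear_combination (h : ℂ) * I_sq, ← div_div, div_self (neg_ne_zero.2 I_ne_zero)]
    · congr 1; push_cast; linear_combination (-h : ℂ) * I_sq
    · congr 1; push_cast; linear_combination (-h : ℂ) * I_sq
  have e3 : I * ∫ y : ℝ in (-h)..h, 1 / ((b : ℂ) + (y : ℂ) * I - l) =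
      log ((b - l : ℝ) + h * I) - log ((b - l : ℝ) - h * I) := by
    have := integral_div_eq_log_sub_log (w := (b - l : ℝ)) (c := I) (s := -h) (t := h)
      (fun y _ => Or.inl (by simpa using hb))
    rw [← intervalIntegral.integral_const_mul]
    refine Eq.trans (intervalIntegral.integral_congr fun x _ => ?_) (this.trans ?_)
    · simp only [mul_one_div]; congr 1; push_cast; ring
    · congr 2 <;> push_cast <;> ring
  have e4 : I * ∫ y : ℝ in (-h)..h, 1 / ((a : ℂ) + (y : ℂ) * I - l) =
      log ((l - a : ℝ) - h * I) - log ((l - a : ℝ) + h * I) := by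
    have := integral_div_eq_log_sub_log (w := (l - a : ℝ)) (c := -I) (s := -h) (t := h)
      (fun y _ => Or.inl (by simpa using ha))
    rw [← intervalIntegral.integral_const_mul]
    refine Eq.trans (intervalIntegral.integral_congr fun x _ => ?_) (this.trans ?_)
    · simp only [mul_one_div]; rw [← neg_div_neg_eq]; congr 1; push_cast; ring
    · congr 2 <;> push_cast <;> ring
  unfold rectIntegral
  rw [e1, e2, e3, e4, log_I_mul_of_re_pos (z := (b - l : ℝ) - h * I) (by simpa using hb),
    log_I_mul_of_re_pos (z := (l - a : ℝ) - h * I) (by simpa using ha),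
    log_neg_I_mul_of_re_pos (z := (b - l : ℝ) + h * I) (by simpa using hb),
    log_neg_I_mul_of_re_pos (z := (l - a : ℝ) + h * I) (by simpa using ha)]
  ring

lemma notMem_rectBoundary {l : ℝ} (hh : 0 < h) (ha : a < l) (hb : l < b) :
    (l : ℂ) ∉ rectBoundary a b h := by
  rintro ⟨-, -, h1⟩
  simp only [ofReal_re, ofReal_im] at h1
  rcases h1 with h1 | h1 | h1 | h1 <;> linarith

lemma rectBoundary_subset : rectBoundary a b h ⊆ Icc a b ×ℂ Icc (-h) h :=
  fun _ hz => ⟨hz.1, hz.2.1⟩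

/-- **Cauchy's integral formula** on a rectangle, for points of the real axis. -/
lemma rectIntegral_div_sub {l : ℝ} (hh : 0 < h) (ha : a < l) (hb : l < b)
    (hf : Differentiable ℂ f) :
    rectIntegral (fun z => f z / (z - l)) a b h = 2 * Real.pi * I * f l := by
  have hab := ha.trans hb
  have hd : Differentiable ℂ (dslope f l) := by
    rw [← differentiableOn_univ] at hf ⊢
    exact (differentiableOn_dslope Filter.univ_mem).2 hf
  have hne : ∀ z ∈ rectBoundary a b h, z - l ≠ 0 := by
    intro z hz h0
    rw [sub_eq_zero] at h0
    exact notMem_rectBoundary hh ha hb (h0 ▸ hz)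
  have hc : ContinuousOn (fun z : ℂ => f l * (1 / (z - l))) (rectBoundary a b h) := by
    refine continuousOn_const.mul (ContinuousOn.div (by fun_prop) (by fun_prop) hne)
  -- The difference quotient of an entire function is entire, so only the pole part f(l)/(z - l)
  -- contributes.
  rw [rectIntegral_congr (g := fun z => dslope f l z + f l * (1 / (z - l))) hab hh,
    rectIntegral_add hab hh hd.continuous.continuousOn hc,
    rectIntegral_eq_zero hab hh hd.differentiableOn, rectIntegral_const_mul,
    rectIntegral_inv_sub hh ha hb]
  · ring
  · intro z hz
    have h1 := sub_smul_dslope f l z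
    have := hne z hz
    simp only [smul_eq_mul] at h1 ⊢
    field_simp
    linear_combination -h1

/-- The **residue theorem** for `f * φ'/φ` where all zeros of `φ` in the rectangle are real and
simple. -/
lemma rectIntegral_mul_logDeriv (hab : a < b) (hh : 0 < h) (hf : Differentiable ℂ f)
    (S : Finset ℝ) (φ : ℂ → ℂ) (hφ : Differentiable ℂ φ)
    (hS : ∀ l ∈ S, a < l ∧ l < b)
    (hzero : ∀ z ∈ Icc a b ×ℂ Icc (-h) h, φ z = 0 ↔ ∃ l ∈ S, z = (l : ℝ))
    (hsimple : ∀ l ∈ S, deriv φ (l : ℝ) ≠ 0) :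
    rectIntegral (fun z => f z * (deriv φ z / φ z)) a b h = 2 * Real.pi * I * ∑ l ∈ S, f l := by
  induction S using Finset.induction_on generalizing φ with
  | empty =>
    simp only [Finset.sum_empty, mul_zero]
    refine rectIntegral_eq_zero hab hh (hf.differentiableOn.mul ?_)
    refine hφ.deriv.differentiableOn.div hφ.differentiableOn fun z hz h0 => ?_
    simpa using (hzero z hz).1 h0
  | insert l S hl ih =>
    have hψ : Differentiable ℂ (dslope φ l) := by
      rw [← differentiableOn_univ] at hφ ⊢
      exact (differentiableOn_dslope Filter.univ_mem).2 hφ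
    obtain ⟨hal, hlb⟩ := hS l (Finset.mem_insert_self _ _)
    have hlmem : (l : ℂ) ∈ Icc a b ×ℂ Icc (-h) h := by
      refine ⟨⟨?_, ?_⟩, ⟨?_, ?_⟩⟩ <;> simp <;> linarith
    have hl0 : φ l = 0 := (hzero l hlmem).2 ⟨l, Finset.mem_insert_self _ _, rfl⟩
    -- Splitting off one zero gives φ'/φ = 1/(z - l) + ψ'/ψ. Simplicity of l makes ψ(l) nonzero, so
    -- ψ has exactly the remaining zeros in the rectangle, again simple.
    have hfac : φ = fun z => (z - l) * dslope φ l z := by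
      ext z
      have := sub_smul_dslope φ l z
      rw [smul_eq_mul, hl0, sub_zero] at this
      exact this.symm
    set ψ := dslope φ l with hψdef
    have hψl : ψ l ≠ 0 := by
      rw [hψdef, dslope_same]; exact hsimple l (Finset.mem_insert_self _ _)
    have hderiv : ∀ z, deriv φ z = ψ z + (z - l) * deriv ψ z := by
      intro z
      have h1 : HasDerivAt (fun z : ℂ => (z - l) * ψ z) (1 * ψ z + (z - l) * deriv ψ z) z :=
        ((hasDerivAt_id z).sub_const (l : ℂ)).mul (hψ z).hasDerivAt
      rw [one_mul] at h1
      rw [← h1.deriv, ← hfac]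
    have hzero' : ∀ z ∈ Icc a b ×ℂ Icc (-h) h, ψ z = 0 ↔ ∃ l ∈ S, z = (l : ℝ) := by
      intro z hz
      constructor
      · intro h0
        have : φ z = 0 := by rw [hfac]; simp [h0]
        obtain ⟨m, hm, rfl⟩ := (hzero z hz).1 this
        rcases Finset.mem_insert.1 hm with rfl | hm
        · exact absurd h0 hψl
        · exact ⟨m, hm, rfl⟩
      · rintro ⟨m, hm, rfl⟩
        have h0 := (hzero m hz).2 ⟨m, Finset.mem_insert_of_mem hm, rfl⟩
        rw [hfac] at h0
        refine (mul_eq_zero.1 h0).resolve_left fun h1 => hl ?_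
        rw [sub_eq_zero] at h1
        rwa [← ofReal_injective h1]
    have hS' : ∀ m ∈ S, a < m ∧ m < b := fun m hm => hS m (Finset.mem_insert_of_mem hm)
    have hsimple' : ∀ m ∈ S, deriv ψ (m : ℝ) ≠ 0 := by
      intro m hm h0
      obtain ⟨ham, hmb⟩ := hS' m hm
      have hmmem : (m : ℂ) ∈ Icc a b ×ℂ Icc (-h) h := by
        refine ⟨⟨?_, ?_⟩, ⟨?_, ?_⟩⟩ <;> simp <;> linarith
      refine hsimple m (Finset.mem_insert_of_mem hm) ?_
      rw [hderiv, h0, (hzero' m hmmem).2 ⟨m, hm, rfl⟩]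
      simp
    have hψb : ∀ z ∈ rectBoundary a b h, ψ z ≠ 0 := by
      intro z hz h0
      obtain ⟨m, hm, rfl⟩ := (hzero' z (rectBoundary_subset hz)).1 h0
      exact notMem_rectBoundary hh (hS' m hm).1 (hS' m hm).2 hz
    have hlb' : ∀ z ∈ rectBoundary a b h, z - l ≠ 0 := by
      intro z hz h0
      rw [sub_eq_zero] at h0
      exact notMem_rectBoundary hh hal hlb (h0 ▸ hz)
    rw [rectIntegral_congr (g := fun z => f z / (z - l) + f z * (deriv ψ z / ψ z)) hab hh,
      rectIntegral_add hab hh, rectIntegral_div_sub hh hal hlb hf,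
      ih ψ hψ hS' hzero' hsimple', Finset.sum_insert hl]
    · ring
    · exact hf.continuous.continuousOn.div (by fun_prop) hlb'
    · exact hf.continuous.continuousOn.mul
        (hψ.deriv.continuous.continuousOn.div hψ.continuous.continuousOn hψb)
    · intro z hz
      have h1 := hψb z hz
      have h2 := hlb' z hz
      have h3 : φ z = (z - l) * ψ z := congrFun hfac z
      simp only [hderiv z, h3]
      field_simp

end RectContour

/-! ### The algebra of exponential polynomials -/

namespace ExpPoly

open Complex AddMonoidAlgebra Filter Topology

/-- The character `γ ↦ e^{2πiγz}` of the additive group of frequencies. -/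
noncomputable def expChar (z : ℂ) : Multiplicative ℝ →* ℂ where
  toFun γ := exp (2 * Real.pi * I * (γ.toAdd : ℝ) * z)
  map_one' := by simp
  map_mul' x y := by rw [← exp_add, toAdd_mul]; congr 1; push_cast; ring

/-- Evaluation at `z` of an exponential polynomial, given by its coefficients. -/
noncomputable def eval (z : ℂ) : ℂ[ℝ] →ₐ[ℂ] ℂ := lift ℂ ℂ ℝ (expChar z)

lemma eval_single (z : ℂ) (γ : ℝ) (c : ℂ) :
    eval z (single γ c) = c * exp (2 * Real.pi * I * γ * z) := by
  simp [eval, expChar]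

lemma eval_apply (z : ℂ) (p : ℂ[ℝ]) :
    eval z p = ∑ γ ∈ p.coeff.support, p.coeff γ * exp (2 * Real.pi * I * γ * z) := by
  simp [eval, expChar, AddMonoidAlgebra.lift_apply, Finsupp.sum]

lemma exists_eval_of_isExpPoly {φ : ℂ → ℂ} (h : IsExpPoly φ) : ∃ p : ℂ[ℝ], ∀ z, φ z = eval z p := by
  obtain ⟨l, α, b, h⟩ := h
  refine ⟨∑ j, single (α j) (b j), fun z => ?_⟩
  simp [h z, map_sum, eval_single]

/-- The derivative of an exponential polynomial. -/
noncomputable def derivative (p : ℂ[ℝ]) : ℂ[ℝ] :=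
  ∑ γ ∈ p.coeff.support, single γ (2 * Real.pi * I * γ * p.coeff γ)

lemma hasDerivAt_eval (p : ℂ[ℝ]) (z : ℂ) :
    HasDerivAt (fun z => eval z p) (eval z (derivative p)) z := by
  rw [funext fun z => eval_apply z p, derivative, map_sum]
  refine HasDerivAt.fun_sum fun γ _ => ?_
  rw [eval_single]
  have := (((hasDerivAt_id z).const_mul (2 * Real.pi * I * γ)).cexp).const_mul (p.coeff γ)
  exact this.congr_deriv (by simp only [id]; ring)

lemma differentiable_eval (p : ℂ[ℝ]) : Differentiable ℂ (fun z => eval z p) :=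
  fun z => (hasDerivAt_eval p z).differentiableAt

/-! ### Lowest frequencies and behaviour high in the upper half-plane -/

/-- All frequencies of `p` are at least `β`. -/
def FreqGE (p : ℂ[ℝ]) (β : ℝ) : Prop := ∀ γ, p.coeff γ ≠ 0 → β ≤ γ

lemma FreqGE.mul {p q : ℂ[ℝ]} {β β' : ℝ} (hp : FreqGE p β) (hq : FreqGE q β') :
    FreqGE (p * q) (β + β') := by
  classical
  intro γ hγ
  obtain ⟨x, hx, y, hy, rfl⟩ :=
    Finset.mem_add.1 (support_coeff_mul_subset p q (Finsupp.mem_support_iff.2 hγ))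
  exact add_le_add (hp x (Finsupp.mem_support_iff.1 hx)) (hq y (Finsupp.mem_support_iff.1 hy))

lemma FreqGE.pow {p : ℂ[ℝ]} {β : ℝ} (hp : FreqGE p β) (n : ℕ) : FreqGE (p ^ n) (n * β) := by
  induction n with
  | zero =>
    intro γ hγ
    by_contra! h
    apply hγ
    simp only [Nat.cast_zero, zero_mul] at h
    rw [pow_zero, one_def, coeff_single, Finsupp.single_apply, if_neg h.ne']
  | succ n ih =>
    rw [pow_succ]
    convert ih.mul hp using 1
    push_cast; ring

lemma norm_exp_freq (γ : ℝ) (z : ℂ) :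
    ‖exp (2 * Real.pi * I * γ * z)‖ = Real.exp (-(2 * Real.pi * γ * z.im)) := by
  rw [norm_exp]
  congr 1
  simp

/-- The sum of the absolute values of the coefficients. -/
noncomputable def coeffNorm (p : ℂ[ℝ]) : ℝ := ∑ γ ∈ p.coeff.support, ‖p.coeff γ‖

lemma FreqGE.norm_eval_le {p : ℂ[ℝ]} {β : ℝ} (hp : FreqGE p β) {z : ℂ} (hz : 0 ≤ z.im) :
    ‖eval z p‖ ≤ coeffNorm p * Real.exp (-(2 * Real.pi * β * z.im)) := by
  rw [eval_apply, coeffNorm, Finset.sum_mul]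
  refine (norm_sum_le _ _).trans (Finset.sum_le_sum fun γ hγ => ?_)
  rw [norm_mul, norm_exp_freq]
  have := hp γ (Finsupp.mem_support_iff.1 hγ)
  gcongr

lemma coeff_derivative_ne_zero {p : ℂ[ℝ]} {γ : ℝ} (h : (derivative p).coeff γ ≠ 0) :
    p.coeff γ ≠ 0 := by
  classical
  intro h0
  apply h
  rw [derivative, coeff_sum, Finsupp.finsetSum_apply]
  refine Finset.sum_eq_zero fun x hx => ?_
  rw [coeff_single, Finsupp.single_apply, if_neg]
  rintro rfl
  exact Finsupp.mem_support_iff.1 hx h0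

/-- Normalisation at the lowest frequency: `φ = c e^{2πiαz} (1 - u)` and `φ' = c e^{2πiαz} v`,
where `u` has positive frequencies only and `v` has nonnegative ones. -/
lemma exists_normal_form {p : ℂ[ℝ]} (hp : p ≠ 0) :
    ∃ (u v : ℂ[ℝ]) (w : ℂ → ℂ) (β : ℝ), 0 < β ∧ FreqGE u β ∧ FreqGE v 0 ∧ (∀ z, w z ≠ 0) ∧
      (∀ z, eval z p = w z * (1 - eval z u)) ∧ ∀ z, eval z (derivative p) = w z * eval z v := by
  classical
  have hs : p.coeff.support.Nonempty := by
    rw [Finsupp.support_nonempty_iff]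
    exact fun h => hp (AddMonoidAlgebra.ext (by simpa using h))
  obtain ⟨α, hα, hmin⟩ := Finset.exists_min_image _ id hs
  have hα0 := Finsupp.mem_support_iff.1 hα
  have hshift : ∀ (q : ℂ[ℝ]) (s : ℝ),
      (single (-α) (p.coeff α)⁻¹ * q).coeff s = (p.coeff α)⁻¹ * q.coeff (s + α) := by
    intro q s
    rw [coeff_single_mul_apply]; congr 2; ring
  -- Dividing p by its lowest-frequency term leaves constant term 1 and otherwise positive
  -- frequencies; -u collects the latter.
  set u : ℂ[ℝ] := 1 - single (-α) (p.coeff α)⁻¹ * p with hu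
  have hu0 : ∀ s, u.coeff s ≠ 0 → s ≠ 0 ∧ p.coeff (s + α) ≠ 0 := by
    intro s hus
    rw [hu, coeff_sub, Finsupp.sub_apply, hshift, one_def, coeff_single,
      Finsupp.single_apply] at hus
    have hs0 : s ≠ 0 := by
      rintro rfl
      apply hus
      simp [inv_mul_cancel₀ hα0]
    refine ⟨hs0, fun h0 => hus ?_⟩
    simp [h0, hs0.symm]
  have hpos : ∀ s ∈ u.coeff.support, 0 < s := by
    intro s hus
    obtain ⟨h1, h2⟩ := hu0 s (Finsupp.mem_support_iff.1 hus)
    have := hmin _ (Finsupp.mem_support_iff.2 h2)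
    simp only [id] at this
    exact lt_of_le_of_ne (by linarith) h1.symm
  obtain ⟨β, hβ, hβu⟩ : ∃ β : ℝ, 0 < β ∧ FreqGE u β := by
    rcases u.coeff.support.eq_empty_or_nonempty with h | h
    -- If p is a single exponential then u = 0, and any positive β will do.
    · refine ⟨1, one_pos, fun γ hγ => absurd (Finsupp.mem_support_iff.2 hγ) ?_⟩
      simp [h]
    · obtain ⟨β, hβ, hβm⟩ := Finset.exists_min_image _ id h
      exact ⟨β, hpos β hβ, fun γ hγ => hβm γ (Finsupp.mem_support_iff.2 hγ)⟩
  have hone : single α (p.coeff α) * single (-α) (p.coeff α)⁻¹ = (1 : ℂ[ℝ]) := by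
    rw [single_mul_single, mul_inv_cancel₀ hα0, add_neg_cancel, one_def]
  refine ⟨u, single (-α) (p.coeff α)⁻¹ * derivative p, fun z => eval z (single α (p.coeff α)), β, hβ,
    hβu, ?_, ?_, ?_, ?_⟩
  · intro s hs
    rw [hshift] at hs
    have := hmin _ (Finsupp.mem_support_iff.2 (coeff_derivative_ne_zero (right_ne_zero_of_mul hs)))
    simp only [id] at this
    linarith
  · intro z
    simp only [eval_single]
    exact mul_ne_zero hα0 (exp_ne_zero _)
  · intro z
    rw [hu, ← map_one (eval z), ← map_sub, sub_sub_cancel, ← map_mul, ← mul_assoc, hone, one_mul]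
  · intro z
    rw [← map_mul, ← mul_assoc, hone, one_mul]

/-- Positive frequencies force decay as Im z → ∞, uniformly in Re z. This is what makes the
geometric series in u converge on a whole line. -/
lemma FreqGE.exists_norm_eval_le_half {u : ℂ[ℝ]} {β : ℝ} (hβ : 0 < β) (hu : FreqGE u β) :
    ∃ H₀ : ℝ, 0 < H₀ ∧ ∀ z : ℂ, H₀ ≤ z.im → ‖eval z u‖ ≤ 1 / 2 := by
  have h1 : Tendsto (fun y : ℝ => coeffNorm u * Real.exp (-(2 * Real.pi * β * y))) atTop (𝓝 0) := by
    rw [← mul_zero (coeffNorm u)]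
    refine Tendsto.const_mul _ (Real.tendsto_exp_neg_atTop_nhds_zero.comp ?_)
    exact tendsto_id.const_mul_atTop (by positivity)
  obtain ⟨H₀, hH⟩ := ((h1.eventually_le_const (show (0 : ℝ) < 1 / 2 by norm_num)).and
    (eventually_gt_atTop 0)).exists_forall_of_atTop
  exact ⟨H₀, (hH H₀ le_rfl).2, fun z hz =>
    (hu.norm_eval_le ((hH H₀ le_rfl).2.le.trans hz)).trans (hH _ hz).1⟩

lemma exists_eval_ne_zero {p : ℂ[ℝ]} (hp : p ≠ 0) : ∃ z, eval z p ≠ 0 := by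
  obtain ⟨u, v, w, β, hβ, hu, -, hw, hpu, -⟩ := exists_normal_form hp
  obtain ⟨H₀, -, hH⟩ := hu.exists_norm_eval_le_half hβ
  refine ⟨H₀ * I, ?_⟩
  rw [hpu]
  refine mul_ne_zero (hw _) fun h => ?_
  have := hH (H₀ * I) (by simp)
  rw [← sub_eq_zero.1 h, norm_one] at this
  norm_num at this

/-! ### Vertical segments away from the zeros -/

/-- A nonzero entire function is free of zeros on some vertical segment over `[0, 1]`. -/
lemma exists_vertical_ne_zero {f : ℂ → ℂ} (hf : Differentiable ℂ f) (h0 : ∃ z, f z ≠ 0) (H : ℝ) :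
    ∃ T ∈ Set.Icc (0 : ℝ) 1, ∀ y ∈ Set.Icc (-H) H, f (T + y * I) ≠ 0 := by
  by_contra! hcon
  choose! y hy hyz using hcon
  -- One zero over each abscissa gives infinitely many in a compact rectangle, contradicting the
  -- identity theorem.
  set A : Set ℂ := (fun T : ℝ => (T : ℂ) + y T * I) '' Set.Icc 0 1
  have hA : A.Infinite := by
    refine (Set.Icc_infinite zero_lt_one).image fun s _ t _ hst => ?_
    simpa using congrArg re hst
  have hK : IsCompact (Set.Icc (0 : ℝ) 1 ×ℂ Set.Icc (-H) H) := isCompact_Icc.reProdIm isCompact_Icc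
  have hAK : A ⊆ Set.Icc (0 : ℝ) 1 ×ℂ Set.Icc (-H) H := by
    rintro _ ⟨T, hT, rfl⟩
    exact ⟨by simpa using hT, by simpa using hy T hT⟩
  obtain ⟨z₀, -, hz₀⟩ := hA.exists_accPt_of_subset_isCompact hK hAK
  have hfr : ∃ᶠ z in 𝓝[≠] z₀, f z = 0 := by
    refine (accPt_iff_frequently_nhdsNE.1 hz₀).mono ?_
    rintro _ ⟨T, hT, rfl⟩
    exact hyz T hT
  have han : AnalyticOnNhd ℂ f Set.univ := fun z _ => hf.analyticAt z
  obtain ⟨z, hz⟩ := h0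
  exact hz (han.eqOn_zero_of_preconnected_of_frequently_eq_zero isPreconnected_univ
    (Set.mem_univ z₀) hfr (Set.mem_univ z))

/-- On every unit interval there is a vertical segment on which an exponential polynomial is
bounded away from zero, with a bound that does not depend on the interval. -/
lemma exists_uniform_vertical {p : ℂ[ℝ]} (hp : p ≠ 0) (H : ℝ) :
    ∃ m : ℝ, 0 < m ∧ ∀ n : ℤ, ∃ T ∈ Set.Icc (n : ℝ) (n + 1), ∀ y ∈ Set.Icc (-H) H,
      m ≤ ‖eval (T + y * I) p‖ := by
  set S := p.coeff.support with hS
  let F : (S → ℂ) → ℂ → ℂ := fun c z => ∑ γ : S, c γ * exp (2 * Real.pi * I * (γ : ℝ) * z)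
  have hFc : Continuous fun q : (S → ℂ) × ℂ => F q.1 q.2 := by
    simp only [F]; fun_prop
  -- The torus of coefficient vectors with the same moduli as those of p contains every integer
  -- translate of p, since translation by n multiplies the coefficient at γ by the phase e^{2πiγn}.
  let K : Set (S → ℂ) := Set.pi Set.univ fun γ => Metric.sphere 0 ‖p.coeff γ‖
  have hK : IsCompact K := isCompact_univ_pi fun γ => isCompact_sphere _ _
  have hmain : ∃ m : ℝ, 0 < m ∧ ∀ c ∈ K, ∃ T ∈ Set.Icc (0 : ℝ) 1, ∀ y ∈ Set.Icc (-H) H,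
      m ≤ ‖F c (T + y * I)‖ := by
    refine hK.induction_on (p := fun U => ∃ m : ℝ, 0 < m ∧ ∀ c ∈ U, ∃ T ∈ Set.Icc (0 : ℝ) 1,
      ∀ y ∈ Set.Icc (-H) H, m ≤ ‖F c (T + y * I)‖) ⟨1, one_pos, by simp⟩ ?_ ?_ ?_
    · rintro U V hUV ⟨m, hm, h⟩
      exact ⟨m, hm, fun c hc => h c (hUV hc)⟩
    · rintro U V ⟨m, hm, h⟩ ⟨m', hm', h'⟩
      refine ⟨min m m', lt_min hm hm', ?_⟩
      rintro c (hc | hc)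
      · obtain ⟨T, hT, h1⟩ := h c hc
        exact ⟨T, hT, fun y hy => (min_le_left _ _).trans (h1 y hy)⟩
      · obtain ⟨T, hT, h1⟩ := h' c hc
        exact ⟨T, hT, fun y hy => (min_le_right _ _).trans (h1 y hy)⟩
    · intro c hc
      let q : ℂ[ℝ] := ∑ γ : S, single (γ : ℝ) (c γ)
      have hqF : ∀ z, eval z q = F c z := by
        intro z
        simp [q, F, map_sum, eval_single]
      have hq0 : q ≠ 0 := by
        obtain ⟨γ, hγ⟩ : S.Nonempty := by
          rw [hS, Finsupp.support_nonempty_iff]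
          exact fun h => hp (AddMonoidAlgebra.ext (by simpa using h))
        intro h0
        have h1 : q.coeff γ = c ⟨γ, hγ⟩ := by
          simp only [q, coeff_sum, Finsupp.finsetSum_apply, coeff_single, Finsupp.single_apply]
          rw [Finset.sum_eq_single ⟨γ, hγ⟩]
          · simp
          · intro b _ hb
            rw [if_neg]
            exact fun h => hb (Subtype.ext h)
          · simp
        rw [h0] at h1
        have h2 : ‖c ⟨γ, hγ⟩‖ = ‖p.coeff γ‖ := by simpa using hc ⟨γ, hγ⟩ (Set.mem_univ _)
        rw [← h1] at h2
        simp only [coeff_zero, Finsupp.coe_zero, Pi.zero_apply, norm_zero] at h2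
        exact Finsupp.mem_support_iff.1 hγ (norm_eq_zero.1 h2.symm)
      obtain ⟨T, hT, hne⟩ := exists_vertical_ne_zero (differentiable_eval q) (exists_eval_ne_zero hq0) H
      simp only [hqF] at hne
      have hcont : Continuous fun q : (S → ℂ) × ℝ => ‖F q.1 (T + q.2 * I)‖ :=
        (hFc.comp (f := fun q : (S → ℂ) × ℝ => (q.1, (T : ℂ) + q.2 * I)) (by fun_prop)).norm
      -- Half the minimum gives a strict inequality, which persists for nearby coefficient vectors
      -- with the same T.
      obtain ⟨m, hm, hmb⟩ : ∃ m : ℝ, 0 < m ∧ ∀ y ∈ Set.Icc (-H) H, m < ‖F c (T + y * I)‖ := by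
        rcases (Set.Icc (-H) H).eq_empty_or_nonempty with he | he
        · exact ⟨1, one_pos, by simp [he]⟩
        · obtain ⟨y₀, hy₀, hmin⟩ := isCompact_Icc.exists_isMinOn he
            (hcont.comp (f := fun y : ℝ => (c, y)) (by fun_prop)).continuousOn
          have hpos := norm_pos_iff.2 (hne y₀ hy₀)
          exact ⟨_, half_pos hpos, fun y hy => (half_lt_self hpos).trans_le (hmin hy)⟩
      have hev : ∀ᶠ c' in 𝓝 c, ∀ y ∈ Set.Icc (-H) H, m < ‖F c' (T + y * I)‖ := by
        refine isCompact_Icc.eventually_forall_of_forall_eventually fun y hy => ?_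
        exact hcont.continuousAt.eventually_const_lt (hmb y hy)
      exact ⟨_, mem_nhdsWithin_of_mem_nhds hev, m, hm, fun c' hc' => ⟨T, hT, fun y hy => (hc' y hy).le⟩⟩
  obtain ⟨m, hm, h⟩ := hmain
  refine ⟨m, hm, fun n => ?_⟩
  obtain ⟨T, hT, hT'⟩ := h (fun γ => p.coeff γ * exp (2 * Real.pi * I * (γ : ℝ) * (n : ℂ))) (by
    intro γ _
    simp [norm_exp])
  refine ⟨n + T, ⟨by linarith [hT.1], by linarith [hT.2]⟩, fun y hy => (hT' y hy).trans_eq ?_⟩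
  congr 1
  rw [eval_apply, ← hS, ← Finset.sum_coe_sort S]
  refine Finset.sum_congr rfl fun γ _ => ?_
  rw [mul_assoc, ← exp_add]
  congr 2
  push_cast; ring

/-! ### The coefficients of `v / (1 - u)` -/

/-- The coefficients of the formal series `v / (1 - u) = ∑ n, v u ^ n`. -/
noncomputable def quotCoeff (u v : ℂ[ℝ]) (s : ℝ) : ℂ := ∑ᶠ n : ℕ, (v * u ^ n).coeff s

/-- The frequencies of v uⁿ are at least nβ, so below any level R only finitely many terms of the
series matter. Hence `quotCoeff` is locally a finite sum. -/
lemma FreqGE.coeff_mul_pow_eq_zero {u v : ℂ[ℝ]} {β R : ℝ} (hβ : 0 < β) (hu : FreqGE u β)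
    (hv : FreqGE v 0) {N n : ℕ} (hN : R < N * β) (hn : N ≤ n) {s : ℝ} (hs : s ≤ R) :
    (v * u ^ n).coeff s = 0 := by
  by_contra h
  have h1 := (hv.mul (hu.pow n)) s h
  have h2 : (N : ℝ) * β ≤ n * β := by gcongr
  linarith

lemma quotCoeff_eq {u v : ℂ[ℝ]} {β R : ℝ} (hβ : 0 < β) (hu : FreqGE u β) (hv : FreqGE v 0) {N : ℕ}
    (hN : R < N * β) {s : ℝ} (hs : s ≤ R) :
    quotCoeff u v s = (∑ n ∈ Finset.range N, v * u ^ n).coeff s := by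
  rw [quotCoeff, coeff_sum, Finsupp.finsetSum_apply, finsum_eq_sum_of_support_subset]
  intro n hn
  rw [Finset.coe_range, Set.mem_Iio]
  by_contra! h
  exact hn (hu.coeff_mul_pow_eq_zero hβ hv hN h hs)

lemma locallyFiniteSupport_quotCoeff {u v : ℂ[ℝ]} {β : ℝ} (hβ : 0 < β) (hu : FreqGE u β)
    (hv : FreqGE v 0) : LocallyFiniteSupport (quotCoeff u v) := by
  intro s₀
  obtain ⟨N, hN⟩ := exists_nat_gt ((s₀ + 1) / β)
  rw [div_lt_iff₀ hβ] at hN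
  refine ⟨Set.Iio (s₀ + 1), Iio_mem_nhds (by linarith),
    ((∑ n ∈ Finset.range N, v * u ^ n).coeff.support.finite_toSet).subset ?_⟩
  rintro s ⟨hs, hs'⟩
  rw [Function.mem_support, quotCoeff_eq hβ hu hv hN (le_of_lt hs)] at hs'
  exact Finsupp.mem_support_iff.2 hs'

end ExpPoly

/-! ### Fourier–Laplace transforms of test functions -/

namespace FourierLaplace

open Complex MeasureTheory Real Filter Topology
open scoped ContDiff

/-- The Fourier–Laplace transform `z ↦ ∫ g(t) e^{-2πitz} dt`. -/
noncomputable def laplace (g : ℝ → ℂ) (z : ℂ) : ℂ := ∫ t : ℝ, g t * cexp (-2 * π * I * t * z)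

lemma norm_cexp_kernel (t : ℝ) (z : ℂ) : ‖cexp (-2 * π * I * t * z)‖ = rexp (2 * π * t * z.im) := by
  rw [norm_exp]; congr 1; simp

/-- `g(t) e^{2πth}` as a test function. -/
noncomputable def tilt (g : ℝ → ℂ) (h : ℝ) (t : ℝ) : ℂ := g t * cexp (2 * π * h * t)

lemma laplace_eq_fourier (g : ℝ → ℂ) (x y : ℝ) : laplace g (x + y * I) = 𝓕 (tilt g y) x := by
  rw [Real.fourier_real_eq_integral_exp_smul, laplace]
  congr 1
  ext t
  rw [tilt, smul_eq_mul, mul_left_comm, ← Complex.exp_add]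
  congr 2
  push_cast
  linear_combination (-2 * π * t * y : ℂ) * I_sq

lemma laplace_ofReal (g : ℝ → ℂ) (x : ℝ) : laplace g x = 𝓕 g x := by
  have h : tilt g 0 = g := by ext t; simp [tilt]
  simpa [h] using laplace_eq_fourier g x 0

variable {g : ℝ → ℂ}

lemma contDiff_tilt (hg : ContDiff ℝ ∞ g) (h : ℝ) : ContDiff ℝ ∞ (tilt g h) := by
  unfold tilt
  refine hg.mul (ContDiff.cexp ?_)
  exact contDiff_const.mul ofRealCLM.contDiff

lemma hasCompactSupport_tilt (hc : HasCompactSupport g) (h : ℝ) : HasCompactSupport (tilt g h) :=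
  hc.mul_right

lemma integrable_laplace_kernel (hg : Continuous g) (hc : HasCompactSupport g) (z : ℂ) :
    Integrable fun t : ℝ => g t * cexp (-2 * π * I * t * z) :=
  Continuous.integrable_of_hasCompactSupport (by fun_prop) hc.mul_right

lemma norm_kernel_le {R : ℝ} (hR : ∀ t, R ≤ ‖t‖ → g t = 0) {z : ℂ} {h : ℝ} (hz : |z.im| ≤ h) (t : ℝ) :
    ‖g t * cexp (-2 * π * I * t * z)‖ ≤ ‖g t‖ * rexp (2 * π * (R * h)) := by
  rw [norm_mul, norm_cexp_kernel]
  rcases le_or_gt R ‖t‖ with h1 | h1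
  · simp [hR t h1]
  · refine mul_le_mul_of_nonneg_left (Real.exp_le_exp.2 ?_) (norm_nonneg _)
    rw [mul_assoc]
    refine mul_le_mul_of_nonneg_left ?_ (by positivity)
    calc t * z.im ≤ |t| * |z.im| := by rw [← abs_mul]; exact le_abs_self _
      _ ≤ R * h := by
        rw [Real.norm_eq_abs] at h1
        exact mul_le_mul h1.le hz (abs_nonneg _) ((abs_nonneg t).trans h1.le)

lemma norm_laplace_le (hg : Continuous g) (hc : HasCompactSupport g) (h : ℝ) :
    ∃ C : ℝ, ∀ z : ℂ, |z.im| ≤ h → ‖laplace g z‖ ≤ C := by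
  obtain ⟨R, -, hR⟩ := hc.exists_pos_le_norm
  refine ⟨∫ t, ‖g t‖ * rexp (2 * π * (R * h)), fun z hz => ?_⟩
  exact norm_integral_le_of_norm_le
    ((hg.integrable_of_hasCompactSupport hc).norm.mul_const _)
    (Eventually.of_forall fun t => norm_kernel_le hR hz t)

lemma differentiable_laplace (hg : Continuous g) (hc : HasCompactSupport g) :
    Differentiable ℂ (laplace g) := by
  intro z₀
  obtain ⟨R, -, hR⟩ := hc.exists_pos_le_norm
  refine (hasDerivAt_integral_of_dominated_loc_of_deriv_le (μ := volume)
    (F := fun z t => g t * cexp (-2 * π * I * t * z))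
    (F' := fun z (t : ℝ) => (g t * (-2 * π * I * t)) * cexp (-2 * π * I * t * z))
    (bound := fun t => ‖g t * (-2 * π * I * t)‖ * rexp (2 * π * (R * (|z₀.im| + 1))))
    (Metric.ball_mem_nhds z₀ one_pos) ?_ ?_ ?_ ?_ ?_ ?_).2.differentiableAt
  · exact Eventually.of_forall fun z => (integrable_laplace_kernel hg hc z).aestronglyMeasurable
  · exact integrable_laplace_kernel hg hc z₀
  · exact (integrable_laplace_kernel (g := fun t : ℝ => g t * (-2 * π * I * t)) (by fun_prop)
      hc.mul_right z₀).aestronglyMeasurable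
  · refine Eventually.of_forall fun t z hz => ?_
    refine norm_kernel_le (g := fun t : ℝ => g t * (-2 * π * I * t))
      (fun t ht => by simp [hR t ht]) ?_ t
    have h1 : |(z - z₀).im| ≤ 1 := (abs_im_le_norm _).trans (mem_ball_iff_norm.1 hz).le
    have h2 : z.im = z₀.im + (z - z₀).im := by simp
    rw [h2]
    exact (abs_add_le _ _).trans (by linarith)
  · refine Integrable.mul_const (Integrable.norm ?_) _
    exact Continuous.integrable_of_hasCompactSupport (by fun_prop) hc.mul_right
  · refine Eventually.of_forall fun t z _ => ?_
    have := (((hasDerivAt_id z).const_mul (-2 * π * I * t)).cexp).const_mul (g t)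
    exact this.congr_deriv (by simp only [id]; ring)

lemma laplace_add_const_mul {f : ℝ → ℂ} (hf : Continuous f) (hfc : HasCompactSupport f)
    (hg : Continuous g) (hc : HasCompactSupport g) (c z : ℂ) :
    laplace (fun t => f t + c * g t) z = laplace f z + c * laplace g z := by
  simp only [laplace]
  rw [← integral_const_mul, ← integral_add (integrable_laplace_kernel hf hfc z)
    ((integrable_laplace_kernel hg hc z).const_mul c)]
  congr 1
  ext t
  ring

/-- On the line Im z = y this is the Fourier derivative rule for `tilt g y`; differentiating the
tilting factor supplies the iy part of z. -/
lemma laplace_deriv (hg : ContDiff ℝ ∞ g) (hc : HasCompactSupport g) (z : ℂ) :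
    laplace (deriv g) z = 2 * π * I * z * laplace g z := by
  obtain ⟨x, y, rfl⟩ : ∃ x y : ℝ, z = x + y * I := ⟨z.re, z.im, (re_add_im z).symm⟩
  have hd : Differentiable ℝ g := hg.differentiable (by simp)
  have hder : deriv (tilt g y) = tilt (fun t => deriv g t + 2 * π * y * g t) y := by
    ext t
    have h1 : HasDerivAt (fun t : ℝ => (2 * π * y * t : ℂ)) (2 * π * y) t := by
      simpa using (hasDerivAt_id t).ofReal_comp.const_mul (2 * π * y : ℂ)
    have h2 := ((hd t).hasDerivAt.fun_mul h1.cexp).deriv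
    unfold tilt
    rw [h2]
    ring
  have hi1 : Integrable (tilt g y) := (contDiff_tilt hg y).continuous.integrable_of_hasCompactSupport
    (hasCompactSupport_tilt hc y)
  have hi2 : Integrable (deriv (tilt g y)) :=
    ((contDiff_tilt hg y).continuous_deriv (by simp)).integrable_of_hasCompactSupport
      (hasCompactSupport_tilt hc y).deriv
  have h1 := congrFun (Real.fourier_deriv hi1 ((contDiff_tilt hg y).differentiable (by simp)) hi2) x
  rw [hder, ← laplace_eq_fourier, ← laplace_eq_fourier, smul_eq_mul,
    laplace_add_const_mul (hg.continuous_deriv (by simp)) hc.deriv hg.continuous hc] at h1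
  linear_combination h1 - (2 * π * y * laplace g (x + y * I)) * I_sq

/-- Two derivatives of g produce the factor (2πiz)², of modulus at least x². The decay is uniform on
the strip, as the horizontal and the vertical sides require. -/
lemma exists_norm_laplace_le (hg : ContDiff ℝ ∞ g) (hc : HasCompactSupport g) (h : ℝ) :
    ∃ C : ℝ, 0 ≤ C ∧ ∀ x y : ℝ, |y| ≤ h → ‖laplace g (x + y * I)‖ ≤ C * (1 + x ^ 2)⁻¹ := by
  have hg1 : ContDiff ℝ ∞ (deriv g) := ((contDiff_infty_iff_deriv).1 hg).2
  have hg2 : ContDiff ℝ ∞ (deriv (deriv g)) := ((contDiff_infty_iff_deriv).1 hg1).2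
  obtain ⟨C₀, hC₀⟩ := norm_laplace_le hg.continuous hc h
  obtain ⟨C₂, hC₂⟩ := norm_laplace_le hg2.continuous hc.deriv.deriv h
  refine ⟨max 0 (C₀ + C₂), le_max_left _ _, fun x y hy => ?_⟩
  set z : ℂ := x + y * I with hz
  have hzim : |z.im| ≤ h := by simpa [hz] using hy
  have h0 := hC₀ z hzim
  have h2 := hC₂ z hzim
  rw [laplace_deriv hg1 hc.deriv, laplace_deriv hg hc, ← mul_assoc, norm_mul] at h2
  have h3 : x ^ 2 ≤ ‖2 * π * I * z * (2 * π * I * z)‖ := by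
    have hx : |x| ≤ ‖z‖ := by simpa [hz] using abs_re_le_norm z
    have hn : ‖2 * π * I * z * (2 * π * I * z)‖ = (2 * π) ^ 2 * ‖z‖ ^ 2 := by
      simp [abs_of_pos Real.pi_pos]; ring
    rw [hn, ← sq_abs x]
    have h4 : (1 : ℝ) ≤ (2 * π) ^ 2 := by nlinarith [Real.pi_gt_three]
    have h5 : |x| ^ 2 ≤ ‖z‖ ^ 2 := by gcongr
    nlinarith [sq_nonneg ‖z‖]
  rw [← div_eq_mul_inv, le_div_iff₀ (by positivity)]
  have h6 := mul_le_mul_of_nonneg_right h3 (norm_nonneg (laplace g z))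
  calc _ ≤ C₀ + C₂ := by nlinarith
    _ ≤ _ := le_max_right _ _

lemma integrable_laplace_line (hg : ContDiff ℝ ∞ g) (hc : HasCompactSupport g) (y : ℝ) :
    Integrable fun x : ℝ => laplace g (x + y * I) := by
  obtain ⟨C, -, hC⟩ := exists_norm_laplace_le hg hc |y|
  refine (integrable_inv_one_add_sq.const_mul C).mono' ?_ (Eventually.of_forall fun x => hC x y le_rfl)
  have := (differentiable_laplace hg.continuous hc).continuous
  exact Continuous.aestronglyMeasurable (by fun_prop)

/-- **Fourier inversion** along a horizontal line. -/
lemma integral_laplace_mul_exp (hg : ContDiff ℝ ∞ g) (hc : HasCompactSupport g) (y γ : ℝ) :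
    ∫ x : ℝ, laplace g (x + y * I) * cexp (2 * π * I * γ * (x + y * I)) = g γ := by
  have hi : Integrable (𝓕 (tilt g y)) := by
    have := integrable_laplace_line hg hc y
    simpa only [laplace_eq_fourier] using this
  have h1 := congrFun (Continuous.fourierInv_fourier_eq (contDiff_tilt hg y).continuous
    ((contDiff_tilt hg y).continuous.integrable_of_hasCompactSupport (hasCompactSupport_tilt hc y)) hi) γ
  rw [Real.fourierInv_eq'] at h1
  have h2 : ∀ x : ℝ, laplace g (x + y * I) * cexp (2 * π * I * γ * (x + y * I)) =
      cexp (-(2 * π * y * γ)) * (cexp (((2 * π * inner ℝ x γ : ℝ) : ℂ) * I) • 𝓕 (tilt g y) x) := by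
    intro x
    rw [laplace_eq_fourier, smul_eq_mul, ← mul_assoc, ← Complex.exp_add, mul_comm]
    congr 2
    simp only [RCLike.inner_apply, conj_trivial]
    push_cast
    linear_combination (2 * π * γ * y : ℂ) * I_sq
  simp_rw [h2]
  rw [integral_const_mul, h1, tilt, mul_left_comm, ← Complex.exp_add]
  simp

end FourierLaplace

/-! ### Logarithmic derivatives of exponential polynomials on horizontal lines -/

namespace ExpPoly

open Complex AddMonoidAlgebra MeasureTheory Filter Topology FourierLaplace
open scoped ContDiff

variable {g : ℝ → ℂ}

lemma integral_laplace_mul_eval (hg : ContDiff ℝ ∞ g) (hc : HasCompactSupport g) (H : ℝ) (p : ℂ[ℝ]) :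
    ∫ x : ℝ, laplace g (x + H * I) * eval (x + H * I) p = ∑ᶠ s : ℝ, p.coeff s * g s := by
  have hint : ∀ γ : ℝ, Integrable fun x : ℝ =>
      p.coeff γ * (laplace g (x + H * I) * exp (2 * Real.pi * I * γ * (x + H * I))) := by
    intro γ
    refine ((integrable_laplace_line hg hc H).mul_bdd (c := Real.exp (-(2 * Real.pi * γ * H)))
      (Continuous.aestronglyMeasurable (by fun_prop)) (Eventually.of_forall fun x => ?_)).const_mul _
    rw [norm_exp_freq]
    simp
  have h1 : ∀ x : ℝ, laplace g (x + H * I) * eval (x + H * I) p = ∑ γ ∈ p.coeff.support,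
      p.coeff γ * (laplace g (x + H * I) * exp (2 * Real.pi * I * γ * (x + H * I))) := by
    intro x
    rw [eval_apply, Finset.mul_sum]
    exact Finset.sum_congr rfl fun γ _ => by ring
  simp_rw [h1]
  rw [integral_finsetSum _ fun γ _ => hint γ, finsum_eq_sum_of_support_subset]
  · refine Finset.sum_congr rfl fun γ _ => ?_
    rw [integral_const_mul, integral_laplace_mul_exp hg hc]
  · intro s hs
    exact Finsupp.mem_support_iff.2 (left_ne_zero_of_mul hs)

lemma norm_quot_le {u v : ℂ[ℝ]} (hv : FreqGE v 0) {z : ℂ} (hz : 0 ≤ z.im)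
    (hu : ‖eval z u‖ ≤ 1 / 2) : ‖eval z v / (1 - eval z u)‖ ≤ coeffNorm v * 2 := by
  have h1 : ‖eval z v‖ ≤ coeffNorm v := by simpa using hv.norm_eval_le hz
  have h2 : 1 / 2 ≤ ‖1 - eval z u‖ := by
    have := norm_sub_norm_le (1 : ℂ) (eval z u)
    rw [norm_one] at this
    linarith
  have h3 : 0 ≤ coeffNorm v := (norm_nonneg _).trans h1
  rw [norm_div, div_le_iff₀ (by linarith)]
  nlinarith

lemma norm_partial_le {u v : ℂ[ℝ]} (hv : FreqGE v 0) {z : ℂ} (hz : 0 ≤ z.im)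
    (hu : ‖eval z u‖ ≤ 1 / 2) (N : ℕ) :
    ‖eval z (∑ n ∈ Finset.range N, v * u ^ n)‖ ≤ coeffNorm v * 2 := by
  have h1 : ‖eval z v‖ ≤ coeffNorm v := by simpa using hv.norm_eval_le hz
  rw [← Finset.mul_sum, map_mul, norm_mul, map_sum]
  refine mul_le_mul h1 ?_ (norm_nonneg _) ((norm_nonneg _).trans h1)
  refine (norm_sum_le _ _).trans (le_trans (Finset.sum_le_sum fun n _ => ?_) (sum_geometric_two_le N))
  rw [map_pow, norm_pow]
  gcongr

lemma tendsto_partial {u : ℂ[ℝ]} (v : ℂ[ℝ]) {z : ℂ} (hu : ‖eval z u‖ ≤ 1 / 2) :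
    Tendsto (fun N => eval z (∑ n ∈ Finset.range N, v * u ^ n)) atTop
      (𝓝 (eval z v / (1 - eval z u))) := by
  have h1 := (hasSum_geometric_of_norm_lt_one
    (hu.trans_lt (by norm_num : (1 / 2 : ℝ) < 1))).tendsto_sum_nat.const_mul (eval z v)
  simpa only [← Finset.mul_sum, map_mul, map_sum, map_pow, div_eq_mul_inv] using h1

/-- The partial sums of the geometric series are bounded independently of N, so dominated
convergence applies. -/
lemma integral_laplace_mul_quot {u v : ℂ[ℝ]} {β H : ℝ} (hβ : 0 < β) (hu : FreqGE u β)
    (hv : FreqGE v 0) (hH : 0 ≤ H) (hsmall : ∀ z : ℂ, H ≤ z.im → ‖eval z u‖ ≤ 1 / 2)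
    (hg : ContDiff ℝ ∞ g) (hc : HasCompactSupport g) :
    Integrable (fun x : ℝ => laplace g (x + H * I) *
      (eval (x + H * I) v / (1 - eval (x + H * I) u))) ∧
    ∫ x : ℝ, laplace g (x + H * I) * (eval (x + H * I) v / (1 - eval (x + H * I) u)) =
      ∑ᶠ s : ℝ, quotCoeff u v s * g s := by
  have him : ∀ x : ℝ, ((x : ℂ) + H * I).im = H := by simp
  have hs : ∀ x : ℝ, ‖eval (x + H * I) u‖ ≤ 1 / 2 := fun x => hsmall _ (him x).ge
  have hline := integrable_laplace_line hg hc H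
  have hmeas : ∀ p : ℂ[ℝ], Continuous fun x : ℝ => eval ((x : ℂ) + H * I) p := fun p =>
    (differentiable_eval p).continuous.comp (by fun_prop : Continuous fun x : ℝ => (x : ℂ) + H * I)
  have hne : ∀ x : ℝ, 1 - eval ((x : ℂ) + H * I) u ≠ 0 := by
    intro x h0
    have := hs x
    rw [← sub_eq_zero.1 h0, norm_one] at this
    norm_num at this
  have hint := hline.mul_bdd (c := coeffNorm v * 2)
    ((hmeas v).div (continuous_const.sub (hmeas u)) hne).aestronglyMeasurable
    (Eventually.of_forall fun x => norm_quot_le hv (hH.trans_eq (him x).symm) (hs x))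
  refine ⟨hint, ?_⟩
  have hlim : Tendsto (fun N => ∫ x : ℝ, laplace g (x + H * I) *
      eval (x + H * I) (∑ n ∈ Finset.range N, v * u ^ n)) atTop
      (𝓝 (∫ x : ℝ, laplace g (x + H * I) * (eval (x + H * I) v / (1 - eval (x + H * I) u)))) := by
    refine tendsto_integral_of_dominated_convergence
      (fun x => ‖laplace g (x + H * I)‖ * (coeffNorm v * 2)) (fun N => ?_)
      (hline.norm.mul_const _) (fun N => Eventually.of_forall fun x => ?_)
      (Eventually.of_forall fun x => (tendsto_partial v (hs x)).const_mul _)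
    · exact hline.aestronglyMeasurable.mul (hmeas _).aestronglyMeasurable
    · rw [norm_mul]
      exact mul_le_mul_of_nonneg_left (norm_partial_le hv (hH.trans_eq (him x).symm) (hs x) N)
        (norm_nonneg _)
  -- The integrals of the partial sums are eventually constant: once Nβ exceeds the radius of the
  -- support of g, further terms have frequencies where g vanishes.
  refine tendsto_nhds_unique hlim (tendsto_const_nhds.congr' ?_)
  obtain ⟨R, -, hR⟩ := hc.exists_pos_le_norm
  obtain ⟨N₀, hN₀⟩ := exists_nat_gt (R / β)
  rw [div_lt_iff₀ hβ] at hN₀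
  filter_upwards [eventually_ge_atTop N₀] with N hN
  have hN' : R < N * β := hN₀.trans_le (by gcongr)
  rw [integral_laplace_mul_eval hg hc]
  refine finsum_congr fun s => ?_
  rcases le_or_gt R ‖s‖ with h | h
  · simp [hR s h]
  · rw [quotCoeff_eq hβ hu hv hN' ((le_abs_self s).trans h.le)]

/-- Integrals of `φ'/φ` against Fourier–Laplace transforms along a high horizontal line are
given by a locally finite atomic measure. -/
lemma exists_upper_line_coeff {φ : ℂ → ℂ} {p : ℂ[ℝ]} (hp : p ≠ 0) (hφ : ∀ z, φ z = eval z p) :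
    ∃ H₀ : ℝ, 0 < H₀ ∧ ∃ a : ℝ → ℂ, LocallyFiniteSupport a ∧ ∀ H, H₀ ≤ H → ∀ g : ℝ → ℂ,
      ContDiff ℝ ∞ g → HasCompactSupport g →
      Integrable (fun x : ℝ => laplace g (x + H * I) *
        (deriv φ (x + H * I) / φ (x + H * I))) ∧
      ∫ x : ℝ, laplace g (x + H * I) * (deriv φ (x + H * I) / φ (x + H * I)) =
        ∑ᶠ s : ℝ, a s * g s := by
  obtain ⟨u, v, w, β, hβ, hu, hv, hw, hpu, hpv⟩ := exists_normal_form hp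
  obtain ⟨H₀, hH₀, hsmall⟩ := hu.exists_norm_eval_le_half hβ
  refine ⟨H₀, hH₀, quotCoeff u v, locallyFiniteSupport_quotCoeff hβ hu hv, fun H hH g hg hc => ?_⟩
  have hq : ∀ z, deriv φ z / φ z = eval z v / (1 - eval z u) := by
    intro z
    have hd : deriv φ z = eval z (derivative p) := by rw [funext hφ, (hasDerivAt_eval p z).deriv]
    rw [hd, hφ, hpu, hpv, mul_div_mul_left _ _ (hw z)]
  simp_rw [hq]
  exact integral_laplace_mul_quot hβ hu hv (hH₀.le.trans hH) (fun z hz => hsmall z (hH.trans hz)) hg hc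

/-! ### Low horizontal lines by reflection -/

/-- The coefficients of `φ(-z)`. -/
noncomputable def reflect (p : ℂ[ℝ]) : ℂ[ℝ] := ∑ γ ∈ p.coeff.support, single (-γ) (p.coeff γ)

lemma eval_reflect (p : ℂ[ℝ]) (z : ℂ) : eval z (reflect p) = eval (-z) p := by
  rw [reflect, map_sum, eval_apply]
  refine Finset.sum_congr rfl fun γ _ => ?_
  rw [eval_single]
  push_cast
  congr 2
  ring

lemma reflect_ne_zero {p : ℂ[ℝ]} (hp : p ≠ 0) : reflect p ≠ 0 := by
  obtain ⟨z, hz⟩ := exists_eval_ne_zero hp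
  intro h0
  apply hz
  rw [← neg_neg z, ← eval_reflect, h0, map_zero]

lemma _root_.LocallyFiniteSupport.comp_neg {a : ℝ → ℂ} (ha : LocallyFiniteSupport a) :
    LocallyFiniteSupport fun s => a (-s) := by
  intro s
  obtain ⟨t, ht, hfin⟩ := ha (-s)
  refine ⟨Neg.neg ⁻¹' t, continuous_neg.continuousAt.preimage_mem_nhds ht, ?_⟩
  exact (hfin.preimage neg_injective.injOn).subset fun x hx => hx

lemma laplace_comp_neg (g : ℝ → ℂ) (z : ℂ) : laplace (fun t => g (-t)) z = laplace g (-z) := by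
  rw [laplace, laplace, ← integral_neg_eq_self]
  congr 1
  ext t
  rw [neg_neg]
  congr 2
  push_cast
  ring

/-- Integrals of `φ'/φ` against Fourier–Laplace transforms along a low horizontal line are
given by a locally finite atomic measure. -/
lemma exists_lower_line_coeff {φ : ℂ → ℂ} {p : ℂ[ℝ]} (hp : p ≠ 0) (hφ : ∀ z, φ z = eval z p) :
    ∃ H₀ : ℝ, 0 < H₀ ∧ ∃ a : ℝ → ℂ, LocallyFiniteSupport a ∧ ∀ H, H₀ ≤ H → ∀ g : ℝ → ℂ,
      ContDiff ℝ ∞ g → HasCompactSupport g →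
      Integrable (fun x : ℝ => laplace g (x + ((-H : ℝ) : ℂ) * I) *
        (deriv φ (x + ((-H : ℝ) : ℂ) * I) / φ (x + ((-H : ℝ) : ℂ) * I))) ∧
      ∫ x : ℝ, laplace g (x + ((-H : ℝ) : ℂ) * I) *
        (deriv φ (x + ((-H : ℝ) : ℂ) * I) / φ (x + ((-H : ℝ) : ℂ) * I)) =
        ∑ᶠ s : ℝ, a s * g s := by
  obtain ⟨H₀, hH₀, a, ha, h⟩ := exists_upper_line_coeff (φ := fun z => φ (-z)) (reflect_ne_zero hp)
    (fun z => by rw [hφ, eval_reflect])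
  -- The outer sign comes from the chain rule for φ(-z), the inner one from reflecting g.
  refine ⟨H₀, hH₀, fun s => -a (-s), ?_, fun H hH g hg hc => ?_⟩
  · intro s
    obtain ⟨t, ht, hfin⟩ := ha.comp_neg s
    exact ⟨t, ht, hfin.subset fun x hx => ⟨hx.1, by simpa using hx.2⟩⟩
  obtain ⟨h1, h2⟩ := h H hH (fun t => g (-t)) (hg.comp contDiff_neg)
    (hc.comp_homeomorph (Homeomorph.neg ℝ))
  have heq : ∀ x : ℝ, laplace g (x + ((-H : ℝ) : ℂ) * I) *
        (deriv φ (x + ((-H : ℝ) : ℂ) * I) / φ (x + ((-H : ℝ) : ℂ) * I)) =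
      -(laplace (fun t => g (-t)) ((-x : ℝ) + H * I) *
        (deriv (fun z => φ (-z)) ((-x : ℝ) + H * I) / φ (-((-x : ℝ) + H * I)))) := by
    intro x
    rw [laplace_comp_neg, deriv_comp_neg,
      show -(((-x : ℝ) : ℂ) + H * I) = x + ((-H : ℝ) : ℂ) * I by push_cast; ring]
    ring
  simp_rw [heq]
  refine ⟨h1.comp_neg.neg, ?_⟩
  rw [integral_neg, integral_neg_eq_self (fun x : ℝ => laplace (fun t => g (-t)) ((x : ℝ) + H * I) *
        (deriv (fun z => φ (-z)) ((x : ℝ) + H * I) / φ (-((x : ℝ) + H * I)))), h2,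
    ← finsum_neg_distrib, ← finsum_comp_equiv (Equiv.neg ℝ)]
  refine finsum_congr fun s => ?_
  simp

end ExpPoly

/-! ### Counting measures of separated sets -/

namespace SeparatedSet

open MeasureTheory Set

variable {Λ : Set ℝ} {δ : ℝ}

lemma injOn_floor (hδ : 0 < δ) (hΛ : ∀ x ∈ Λ, ∀ y ∈ Λ, x ≠ y → δ ≤ |x - y|) :
    InjOn (fun x : ℝ => ⌊x / δ⌋) Λ := by
  intro x hx y hy hxy
  by_contra hne
  have h1 := Int.abs_sub_lt_one_of_floor_eq_floor hxy
  rw [← sub_div, abs_div, abs_of_pos hδ, div_lt_one hδ] at h1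
  exact absurd (hΛ x hx y hy hne) (not_le.2 h1)

lemma finite_inter_Icc (hδ : 0 < δ) (hΛ : ∀ x ∈ Λ, ∀ y ∈ Λ, x ≠ y → δ ≤ |x - y|) (a b : ℝ) :
    (Λ ∩ Icc a b).Finite := by
  refine Finite.of_finite_image ((finite_Icc ⌊a / δ⌋ ⌊b / δ⌋).subset ?_)
    ((injOn_floor hδ hΛ).mono inter_subset_left)
  rintro _ ⟨x, ⟨-, hx⟩, rfl⟩
  exact ⟨Int.floor_le_floor (by gcongr; exact hx.1), Int.floor_le_floor (by gcongr; exact hx.2)⟩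

lemma measurableSet (hδ : 0 < δ) (hΛ : ∀ x ∈ Λ, ∀ y ∈ Λ, x ≠ y → δ ≤ |x - y|) :
    MeasurableSet Λ :=
  (countable_of_injective_of_countable_image (injOn_floor hδ hΛ) (to_countable _)).measurableSet

lemma summable_one_add_abs_inv_sq : Summable fun k : ℤ => ((1 + |(k : ℝ)|) ^ 2)⁻¹ := by
  have h : Summable fun n : ℕ => ((1 + (n : ℝ)) ^ 2)⁻¹ := by
    have := (summable_nat_add_iff 1).2 (Real.summable_one_div_nat_pow.2 (one_lt_two))
    refine this.congr fun n => ?_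
    push_cast
    rw [one_div, add_comm]
  refine Summable.of_nat_of_neg ?_ ?_ <;> simpa using h

/-- The integers ⌊x/δ⌋ are distinct for x in Λ, and 1 + |⌊x/δ⌋| ≤ (2 + 1/δ)(1 + |x|), so the sum of
(1 + |x|)⁻² is dominated by a convergent sum over ℤ. -/
lemma hasTemperateGrowth (hδ : 0 < δ) (hΛ : ∀ x ∈ Λ, ∀ y ∈ Λ, x ≠ y → δ ≤ |x - y|) :
    (Measure.count.restrict Λ).HasTemperateGrowth := by
  refine ⟨2, ?_⟩
  change IntegrableOn _ Λ _
  rw [← integrable_indicator_iff (measurableSet hδ hΛ), integrable_count_iff, summable_norm_iff,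
    ← summable_subtype_iff_indicator]
  have h1 := (summable_one_add_abs_inv_sq.comp_injective
    (i := fun x : Λ => ⌊(x : ℝ) / δ⌋) (fun x y h => Subtype.ext (injOn_floor hδ hΛ x.2 y.2 h))).mul_left
    ((2 + 1 / δ) ^ 2)
  refine h1.of_nonneg_of_le (fun x => ?_) fun x => ?_
  · simp only [Function.comp]; positivity
  · simp only [Function.comp, Real.norm_eq_abs]
    rw [Real.rpow_neg (by positivity), ← div_eq_mul_inv, Real.rpow_natCast, inv_eq_one_div,
      div_le_div_iff₀ (by positivity) (by positivity), one_mul, ← mul_pow]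
    gcongr
    have h2 : |(⌊(x : ℝ) / δ⌋ : ℝ)| ≤ |(x : ℝ) / δ| + 1 := by
      have h3 := Int.floor_le ((x : ℝ) / δ)
      have h4 := Int.lt_floor_add_one ((x : ℝ) / δ)
      have h5 := neg_abs_le ((x : ℝ) / δ)
      have h6 := le_abs_self ((x : ℝ) / δ)
      rw [abs_le]
      constructor <;> linarith
    rw [abs_div, abs_of_pos hδ] at h2
    have h7 : (2 + 1 / δ) * (1 + |(x : ℝ)|) = 2 + 2 * |(x : ℝ)| + 1 / δ + |(x : ℝ)| / δ := by ring
    have h8 : 0 < 1 / δ := by positivity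
    have h9 := abs_nonneg (x : ℝ)
    linarith

lemma setIntegral_count {S : Finset ℝ} {a b : ℝ} (hS : (S : Set ℝ) = Λ ∩ Ioc a b) (f : ℝ → ℂ) :
    ∫ x in Ioc a b, f x ∂(Measure.count.restrict Λ) = ∑ x ∈ S, f x := by
  have : IsFiniteMeasure (Measure.count.restrict (S : Set ℝ)) :=
    ⟨by simp [Measure.count_apply_finset]⟩
  rw [Measure.restrict_restrict measurableSet_Ioc, inter_comm, ← hS, setIntegral_finset]
  · simp [Measure.real]
  · have := IntegrableOn.finset (μ := Measure.count.restrict (S : Set ℝ)) (s := S) (f := f)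
    rwa [IntegrableOn, Measure.restrict_restrict S.measurableSet, inter_self] at this

lemma isAtomicMeasure (hδ : 0 < δ) (hΛ : ∀ x ∈ Λ, ∀ y ∈ Λ, x ≠ y → δ ≤ |x - y|) :
    haveI := hasTemperateGrowth hδ hΛ
    IsAtomicMeasure (Measure.count.restrict Λ).toTemperedDistribution (unitMasses Λ) := by
  have := hasTemperateGrowth hδ hΛ
  constructor
  · intro x
    refine ⟨Icc (x - 1) (x + 1), Icc_mem_nhds (by linarith) (by linarith),
      (finite_inter_Icc hδ hΛ (x - 1) (x + 1)).subset ?_⟩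
    rintro y ⟨hy, hy'⟩
    exact ⟨mem_of_indicator_ne_zero hy', hy⟩
  · intro f hf
    obtain ⟨R, -, hR⟩ := hf.exists_pos_le_norm
    have hfin : (Λ ∩ Ioc (-R) R).Finite :=
      (finite_inter_Icc hδ hΛ (-R) R).subset (inter_subset_inter_right _ Ioc_subset_Icc_self)
    have hzero : ∀ x ∉ Ioc (-R) R, f x = 0 := by
      intro x hx
      apply hR
      by_contra! h
      rw [Real.norm_eq_abs, abs_lt] at h
      exact hx ⟨h.1, h.2.le⟩
    rw [Measure.toTemperedDistribution_apply (Measure.count.restrict Λ), ← setIntegral_eq_integral_of_forall_compl_eq_zero hzero,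
      setIntegral_count hfin.coe_toFinset, finsum_eq_sum_of_support_subset (s := hfin.toFinset)]
    · refine Finset.sum_congr rfl fun x hx => ?_
      rw [unitMasses, indicator_of_mem ((hfin.mem_toFinset.1 hx).1), Pi.one_apply, one_mul]
    · intro x hx
      rw [hfin.coe_toFinset]
      refine ⟨mem_of_indicator_ne_zero (left_ne_zero_of_mul hx), ?_⟩
      by_contra h
      exact right_ne_zero_of_mul hx (hzero x h)

end SeparatedSet

/-! ### The summation formula -/

namespace ExpPoly

open Complex AddMonoidAlgebra MeasureTheory Filter Topology FourierLaplace RectContour Set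
open scoped ContDiff

lemma norm_eval_le_of_abs_im_le (p : ℂ[ℝ]) (H : ℝ) :
    ∃ C : ℝ, 0 ≤ C ∧ ∀ z : ℂ, |z.im| ≤ H → ‖eval z p‖ ≤ C := by
  refine ⟨∑ γ ∈ p.coeff.support, ‖p.coeff γ‖ * Real.exp (2 * Real.pi * (|γ| * H)), by positivity,
    fun z hz => ?_⟩
  rw [eval_apply]
  refine (norm_sum_le _ _).trans (Finset.sum_le_sum fun γ _ => ?_)
  rw [norm_mul, norm_exp_freq]
  refine mul_le_mul_of_nonneg_left (Real.exp_le_exp.2 ?_) (norm_nonneg _)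
  have h1 : -(γ * z.im) ≤ |γ| * H := by
    calc -(γ * z.im) ≤ |γ * z.im| := neg_le_abs _
      _ = |γ| * |z.im| := abs_mul _ _
      _ ≤ |γ| * H := by gcongr
  nlinarith [Real.pi_pos]

variable {φ : ℂ → ℂ} {p : ℂ[ℝ]} {g : ℝ → ℂ} {H m : ℝ}

/-- The transform of g is O(1/T²), φ' is bounded on the strip, and |φ| ≥ m on the chosen segments.
-/
lemma tendsto_vertical_integral (hφ : ∀ z, φ z = eval z p) (hH : 0 < H) (hm : 0 < m)
    (hg : ContDiff ℝ ∞ g) (hc : HasCompactSupport g) {T : ℕ → ℝ}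
    (hT : Tendsto (fun n => |T n|) atTop atTop)
    (hTm : ∀ n, ∀ y ∈ Icc (-H) H, m ≤ ‖φ (T n + y * I)‖) :
    Tendsto (fun n => ∫ y : ℝ in (-H)..H, laplace g (T n + y * I) *
      (deriv φ (T n + y * I) / φ (T n + y * I))) atTop (𝓝 0) := by
  obtain ⟨C, hC0, hC⟩ := exists_norm_laplace_le hg hc H
  obtain ⟨D, hD0, hD⟩ := norm_eval_le_of_abs_im_le (derivative p) H
  have hderiv : ∀ z, deriv φ z = eval z (derivative p) := fun z => by
    rw [funext hφ, (hasDerivAt_eval p z).deriv]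
  have hbound : ∀ n, ‖∫ y : ℝ in (-H)..H, laplace g (T n + y * I) *
      (deriv φ (T n + y * I) / φ (T n + y * I))‖ ≤
      C * (1 + |T n| ^ 2)⁻¹ * (D / m) * |H - -H| := by
    intro n
    refine intervalIntegral.norm_integral_le_of_norm_le_const fun y hy => ?_
    rw [uIoc_of_le (by linarith)] at hy
    have hy' : |y| ≤ H := abs_le.2 ⟨hy.1.le, hy.2⟩
    rw [norm_mul, norm_div, hderiv, sq_abs]
    gcongr
    · exact hC _ _ hy'
    · exact hD _ (by simpa using hy')
    · exact hTm n y ⟨hy.1.le, hy.2⟩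
  refine squeeze_zero_norm hbound ?_
  have h1 : Tendsto (fun n => (1 + |T n| ^ 2)⁻¹) atTop (𝓝 0) :=
    (tendsto_atTop_add_const_left _ _ ((tendsto_pow_atTop two_ne_zero).comp hT)).inv_tendsto_atTop
  simpa using ((h1.const_mul C).mul_const (D / m)).mul_const |H - -H|

/-- The sum of a Fourier–Laplace transform over the real and simple zeros of an exponential
polynomial `φ`, as a difference of two integrals against `φ'/φ`. -/
lemma integral_count_zeros (hp : p ≠ 0) (hφ : ∀ z, φ z = eval z p) (hH : 0 < H)
    {Λ : Set ℝ} (hΛ : ∀ z, φ z = 0 ↔ ∃ l ∈ Λ, z = (l : ℝ))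
    (hsimple : ∀ l ∈ Λ, deriv φ (l : ℝ) ≠ 0) (hfin : ∀ a b, (Λ ∩ Icc a b).Finite)
    (hg : ContDiff ℝ ∞ g) (hc : HasCompactSupport g)
    (hint : Integrable (fun x : ℝ => laplace g x) (Measure.count.restrict Λ))
    (htop : Integrable fun x : ℝ => laplace g (x + (H : ℂ) * I) *
        (deriv φ (x + (H : ℂ) * I) / φ (x + (H : ℂ) * I)))
    (hbot : Integrable fun x : ℝ => laplace g (x + ((-H : ℝ) : ℂ) * I) *
        (deriv φ (x + ((-H : ℝ) : ℂ) * I) / φ (x + ((-H : ℝ) : ℂ) * I))) :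
    2 * Real.pi * I * ∫ x : ℝ, laplace g x ∂(Measure.count.restrict Λ) =
      (∫ x : ℝ, laplace g (x + ((-H : ℝ) : ℂ) * I) *
        (deriv φ (x + ((-H : ℝ) : ℂ) * I) / φ (x + ((-H : ℝ) : ℂ) * I))) -
      ∫ x : ℝ, laplace g (x + (H : ℂ) * I) *
        (deriv φ (x + (H : ℂ) * I) / φ (x + (H : ℂ) * I)) := by
  obtain ⟨m, hm, hcut⟩ := exists_uniform_vertical hp H
  simp only [← hφ] at hcut
  -- The abscissas lie in [n + 1, n + 2] on the right and in [-(n + 2), -(n + 1)] on the left, so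
  -- the rectangles are nondegenerate already for n = 0 and exhaust the strip.
  choose B hB hBm using fun n : ℕ => hcut (n + 1)
  choose A hA hAm using fun n : ℕ => hcut (-(n + 2))
  push_cast at hA hB
  have hAlt : ∀ n : ℕ, A n ≤ -(n + 1) := fun n => by linarith [(hA n).2]
  have hBgt : ∀ n : ℕ, (n : ℝ) + 1 ≤ B n := fun n => (hB n).1
  have hAB : ∀ n, A n < B n := fun n => by
    have := Nat.cast_nonneg (α := ℝ) n
    linarith [hAlt n, hBgt n]
  have hnat : Tendsto (fun n : ℕ => (n : ℝ) + 1) atTop atTop :=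
    tendsto_atTop_add_const_right _ _ tendsto_natCast_atTop_atTop
  have hBt : Tendsto B atTop atTop := tendsto_atTop_mono hBgt hnat
  have hAt : Tendsto A atTop atBot := tendsto_atBot_mono hAlt (tendsto_neg_atTop_atBot.comp hnat)
  have hvert : ∀ {T : ℝ}, (∀ y ∈ Icc (-H) H, m ≤ ‖φ (T + y * I)‖) → T ∉ Λ := by
    intro T hT hmem
    have h0 := hT 0 ⟨by linarith, hH.le⟩
    have h1 : φ (T : ℝ) = 0 := (hΛ _).2 ⟨T, hmem, rfl⟩
    simp only [ofReal_zero, zero_mul, add_zero, h1, norm_zero] at h0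
    linarith
  have hrect : ∀ n, 2 * Real.pi * I * ∫ x in (A n)..(B n), laplace g x ∂(Measure.count.restrict Λ) =
      rectIntegral (fun z => laplace g z * (deriv φ z / φ z)) (A n) (B n) H := by
    intro n
    have hf : (Λ ∩ Ioc (A n) (B n)).Finite :=
      (hfin _ _).subset (inter_subset_inter_right _ Ioc_subset_Icc_self)
    have hmem : ∀ l, l ∈ hf.toFinset ↔ l ∈ Λ ∧ A n < l ∧ l < B n := by
      intro l
      rw [hf.mem_toFinset]
      refine ⟨fun h => ⟨h.1, h.2.1, lt_of_le_of_ne h.2.2 ?_⟩, fun h => ⟨h.1, h.2.1, h.2.2.le⟩⟩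
      rintro rfl
      exact hvert (hBm n) h.1
    rw [intervalIntegral.integral_of_le (hAB n).le,
      SeparatedSet.setIntegral_count hf.coe_toFinset,
      rectIntegral_mul_logDeriv (hAB n) hH (differentiable_laplace hg.continuous hc) hf.toFinset φ]
    · rw [funext hφ]; exact differentiable_eval p
    · exact fun l hl => ((hmem l).1 hl).2
    · intro z hz
      rw [hΛ]
      constructor
      · rintro ⟨l, hl, rfl⟩
        have h1 : A n ≤ l ∧ l ≤ B n := by simpa using hz.1
        refine ⟨l, (hmem l).2 ⟨hl, lt_of_le_of_ne h1.1 ?_, lt_of_le_of_ne h1.2 ?_⟩, rfl⟩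
        · rintro rfl
          exact hvert (hAm n) hl
        · rintro rfl
          exact hvert (hBm n) hl
      · rintro ⟨l, hl, rfl⟩
        exact ⟨l, ((hmem l).1 hl).1, rfl⟩
    · exact fun l hl => hsimple l ((hmem l).1 hl).1
  have hlim1 := (intervalIntegral_tendsto_integral hint hAt hBt).const_mul (2 * Real.pi * I)
  have hR := tendsto_vertical_integral hφ hH hm hg hc (tendsto_abs_atTop_atTop.comp hBt) hBm
  have hL := tendsto_vertical_integral hφ hH hm hg hc (tendsto_abs_atBot_atTop.comp hAt) hAm
  have hlim2 := (((intervalIntegral_tendsto_integral hbot hAt hBt).sub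
    (intervalIntegral_tendsto_integral htop hAt hBt)).add (hR.const_mul I)).sub (hL.const_mul I)
  simp only [mul_zero, add_zero, sub_zero] at hlim2
  exact tendsto_nhds_unique hlim1 (hlim2.congr fun n => (hrect n).symm)

/-- The counting measure of the zeros of an exponential polynomial with real, simple and uniformly
discrete zeros is crystalline. -/
theorem isCrystallineMeasure_zeros (φ : ℂ → ℂ) (hφ : IsExpPolyR φ) :
    IsCrystallineMeasure (unitMasses {x : ℝ | (x : ℂ) ∈ zeroSet φ}) := by
  obtain ⟨p, hp⟩ := exists_eval_of_isExpPoly hφ.isExpPoly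
  -- The zero function would vanish at i, which is not real.
  have hp0 : p ≠ 0 := by
    rintro rfl
    have := hφ.real Complex.I (by simp [zeroSet, hp])
    simp at this
  set Λ : Set ℝ := {x : ℝ | (x : ℂ) ∈ zeroSet φ} with hΛdef
  have hΛ : ∀ z, φ z = 0 ↔ ∃ l ∈ Λ, z = (l : ℝ) := by
    intro z
    constructor
    · intro hz
      have hre : ((z.re : ℝ) : ℂ) = z := by
        apply Complex.ext <;> simp [hφ.real z hz]
      exact ⟨z.re, by rw [hΛdef, Set.mem_ofPred_eq, hre]; exact hz, hre.symm⟩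
    · rintro ⟨l, hl, rfl⟩
      exact hl
  obtain ⟨δ, hδ, hsep⟩ : ∃ δ : ℝ, 0 < δ ∧ ∀ x ∈ Λ, ∀ y ∈ Λ, x ≠ y → δ ≤ |x - y| := by
    obtain ⟨d, hd0, hd⟩ := ENNReal.lt_iff_exists_nnreal_btwn.1 hφ.uniformlyDiscrete
    refine ⟨d, by simpa using hd0, fun x hx y hy hxy => ?_⟩
    have h1 := Set.le_edist_of_le_einfsep (x := (x : ℂ)) (y := (y : ℂ)) hx hy (by simpa using hxy) hd.le
    rw [edist_nndist, ENNReal.coe_le_coe, ← NNReal.coe_le_coe, coe_nndist, Complex.dist_eq,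
      ← Complex.ofReal_sub, Complex.norm_real, Real.norm_eq_abs] at h1
    exact h1
  have := SeparatedSet.hasTemperateGrowth hδ hsep
  obtain ⟨H₁, hH₁, a, ha, hup⟩ := exists_upper_line_coeff hp0 hp
  obtain ⟨H₂, hH₂, b, hb, hlow⟩ := exists_lower_line_coeff hp0 hp
  refine ⟨_, SeparatedSet.isAtomicMeasure hδ hsep,
    -- Low line minus high line: the anticlockwise contour runs along the bottom edge in the
    -- positive direction.
    fun s => (2 * Real.pi * Complex.I)⁻¹ * (b s - a s), ?_, fun g hc => ?_⟩
  · intro s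
    obtain ⟨t, ht, hft⟩ := ha s
    obtain ⟨t', ht', hft'⟩ := hb s
    refine ⟨t ∩ t', Filter.inter_mem ht ht', (hft.union hft').subset ?_⟩
    rintro x ⟨⟨hx, hx'⟩, hne⟩
    by_cases h : a x = 0
    · refine Or.inr ⟨hx', fun h' => hne ?_⟩
      simp [h, h']
    · exact Or.inl ⟨hx, h⟩
  · have hg := g.smooth ⊤
    obtain ⟨hi1, he1⟩ := hup (max H₁ H₂) (le_max_left _ _) g hg hc
    obtain ⟨hi2, he2⟩ := hlow (max H₁ H₂) (le_max_right _ _) g hg hc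
    have hlap : ∀ x : ℝ, laplace g x = (𝓕 g : 𝓢(ℝ, ℂ)) x := by
      intro x
      rw [laplace_ofReal, SchwartzMap.fourier_coe]
    have key := integral_count_zeros hp0 hp (hH₁.trans_le (le_max_left _ H₂)) hΛ
      (fun l hl => hφ.simple l hl) (SeparatedSet.finite_inter_Icc hδ hsep) hg hc
      (by simpa only [hlap] using (𝓕 g : 𝓢(ℝ, ℂ)).integrable) hi1 hi2
    simp only [hlap] at key
    -- Finite support is needed to subtract the two `finsum`s termwise.
    have hfinite : ∀ c : ℝ → ℂ, LocallyFiniteSupport c →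
        (Function.support fun s => c s * g s).Finite := by
      intro c hcl
      have h1 := hcl.finite_inter_support_of_isCompact hc.isCompact
      refine h1.subset fun s hs => ⟨subset_tsupport _ (right_ne_zero_of_mul hs),
        left_ne_zero_of_mul hs⟩
    rw [TemperedDistribution.fourier_apply,
      Measure.toTemperedDistribution_apply (Measure.count.restrict Λ)]
    apply mul_left_cancel₀ Complex.two_pi_I_ne_zero
    rw [key, he1, he2, ← finsum_sub_distrib (hfinite b hb) (hfinite a ha), mul_finsum]
    refine finsum_congr fun s => ?_
    rw [← mul_assoc, ← mul_assoc, mul_inv_cancel₀ Complex.two_pi_I_ne_zero]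
    ring

end ExpPoly

theorem corollary2 (φ : ℂ → ℂ) (hφ : IsExpPolyR φ) :
    IsCrystallineMeasure (unitMasses {x : ℝ | (x : ℂ) ∈ zeroSet φ}) := by
  exact ExpPoly.isCrystallineMeasure_zeros φ hφ
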